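/- Let $\mathcal C$ be a locally finitely presentable category and let $H\colon\mathcal C\to\mathcal C$ be a functor which preserves filtered colimits and preserves non-empty monomorphisms, i.e. $Hm$ is monic for every mono $m\colon X\rightarrowtail Y$ whose domain $X$ is not a strict initial object (an initial object $0$ is strict if every morphism $I\to 0$ is an isomorphism). An object $X$ is finitely presentable (fp) if $\mathcal C(X,-)$ preserves filtered colimits, finitely generated (fg) if $\mathcal C(X,-)$ preserves colimits of directed diagrams all of whose connecting morphisms are monic, and projective if for every strong epi $e\colon A\twoheadrightarrow B$ and every $f\colon X\to B$ there is $f'\colon X\to A$ with $e\cdot f'=f$. Assume moreover that every fp object $X$ admits a strong epi $P\twoheadrightarrow X$ with $P$ fp and projective, and that $H$ preserves strong epis. An $H$-coalgebra is a pair $(C,c)$ with $c\colon C\to HC$; a homomorphism $f\colon (C,c)\to(D,d)$ is a morphism $f\colon C\to D$ with $d\cdot f=Hf\cdot c$; it is called mono-carried or strong epi-carried if $f$ is monic or a strong epi in $\mathcal C$, respectively. A coalgebra is fp-carried (fg-carried) if its carrier is fp (fg). A coalgebra is lfp if it is a filtered colimit, in the category of $H$-coalgebras, of fp-carried coalgebras.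 A coalgebra $(X,x)$ is lfg if for every fg object $S$ and every morphism $f\colon S\to X$ there are an fg-carried coalgebra $(P,p)$, a homomorphism $h\colon(P,p)\to(X,x)$ and a morphism $f'\colon S\to P$ with $h\cdot f'=f$. The rational fixpoint $\varrho H$ is the final lfp coalgebra, the locally finite fixpoint (LFF) $\vartheta H$ is the final lfg coalgebra, and $\nu H$ is the final $H$-coalgebra (final objects of the respective full subcategories of the category of $H$-coalgebras). Then: 1. For every fg-carried coalgebra $(X,x)$ there are an fp-carried coalgebra $(P,p)$ and a strong epi-carried homomorphism $(P,p)\twoheadrightarrow(X,x)$. 2. The coalgebras $\varrho H$, $\vartheta H$ and $\nu H$ exist, and $\vartheta H$ is the image of $\varrho H$ in $\nu H$: the unique homomorphism $\varrho H\to\nu H$ factorizes as $\varrho H\twoheadrightarrow\vartheta H\rightarrowtail\nu H$, where the first homomorphism is strong epi-carried and the second one is mono-carried. -/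

import Mathlib

open CategoryTheory CategoryTheory.Limits CategoryTheory.Endofunctor

universe v u

namespace LocFin

variable {C : Type u} [Category.{v} C]

/-- An object `X` is finitely generated if `C(X, -)` preserves colimits of directed diagrams
all of whose connecting morphisms are monic. (A directed poset is non-empty.) -/
def IsFinitelyGenerated (X : C) : Prop :=
  ∀ (I : Type v) [PartialOrder I] [IsDirectedOrder I] [Nonempty I] (D : I ⥤ C),
    (∀ ⦃i j : I⦄ (f : i ⟶ j), Mono (D.map f)) →
      PreservesColimit D (coyoneda.obj (Opposite.op X))

/-- `X` is projective with respect to strong epimorphisms. -/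
def IsStrongProjective (X : C) : Prop :=
  ∀ ⦃A B : C⦄ (e : A ⟶ B) [StrongEpi e] (f : X ⟶ B), ∃ f' : X ⟶ A, f' ≫ e = f

/-- `Y` is a strong quotient of `X`. -/
def IsStrongQuotientOf (Y X : C) : Prop :=
  ∃ q : X ⟶ Y, StrongEpi q

/-- `X` is an initial object, and every morphism into `X` is an isomorphism. -/
def IsStrictInitial (X : C) : Prop :=
  Nonempty (IsInitial X) ∧ ∀ ⦃Y : C⦄ (f : Y ⟶ X), IsIso f

/-- `H` preserves non-empty monos, i.e. monos whose domain is not a strict initial object. -/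
def PreservesNonemptyMonos (H : C ⥤ C) : Prop :=
  ∀ ⦃X Y : C⦄ (m : X ⟶ Y) [Mono m], ¬ IsStrictInitial X → Mono (H.map m)

/-- `H` preserves strong epimorphisms. -/
def PreservesStrongEpis (H : C ⥤ C) : Prop :=
  ∀ ⦃X Y : C⦄ (e : X ⟶ Y) [StrongEpi e], StrongEpi (H.map e)

/-- Coalgebras with finitely presentable carrier. -/
def fpCarried (H : C ⥤ C) : ObjectProperty (Coalgebra H) :=
  fun A => IsFinitelyPresentable.{v} A.V

/-- Coalgebras with finitely generated carrier. -/
def fgCarried (H : C ⥤ C) : ObjectProperty (Coalgebra H) :=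
  fun A => IsFinitelyGenerated A.V

/-- The lfp coalgebras: (small) filtered colimits, in the category of coalgebras, of coalgebras
with finitely presentable carrier. -/
def isLfp (H : C ⥤ C) : ObjectProperty (Coalgebra H) :=
  fun A => ∃ (J : Type v) (_ : SmallCategory J) (_ : IsFiltered J),
    (fpCarried H).colimitsOfShape J A

/-- The lfg (locally finitely generated) coalgebras: every morphism from a finitely generated
object to the carrier of `A` factorizes through a homomorphism from a coalgebra with finitely
generated carrier. -/
def isLfg (H : C ⥤ C) : ObjectProperty (Coalgebra H) :=
  fun A => ∀ ⦃S : C⦄, IsFinitelyGenerated S → ∀ f : S ⟶ A.V,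
    ∃ (P : Coalgebra H) (_ : fgCarried H P) (h : P ⟶ A) (f' : S ⟶ P.V), f' ≫ h.f = f

/-- `X` is a final object of the full subcategory given by `P`. -/
def IsFinalIn {D : Type*} [Category* D] (P : ObjectProperty D) (X : D) : Prop :=
  P X ∧ ∀ Y : D, P Y → Nonempty (Unique (Y ⟶ X))

/-- The rational fixpoint of `H`: the final lfp coalgebra. -/
def IsRationalFixpoint (H : C ⥤ C) (R : Coalgebra H) : Prop :=
  IsFinalIn (isLfp H) R

/-- The locally finite fixpoint of `H`: the final lfg coalgebra. -/
def IsLocallyFiniteFixpoint (H : C ⥤ C) (L : Coalgebra H) : Prop :=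
  IsFinalIn (isLfg H) L

end LocFin

-- Fp objects that are projective for strong epis form a generator `G`, whose maps into an object
-- behave like elements: equality, monicity and factorization through a mono can be tested on them,
-- and images exist.
--
-- Existence: the coalgebras with `κ`-presentable carrier form an essentially small `κ`-filtered
-- category, and its colimit, computed on carriers, receives exactly one homomorphism from each of
-- them. For `κ = ℵ₀` this colimit is `ϱH`. For `κ = ℵ₁` it is `νH`, because every coalgebra is
-- covered by `ℵ₁`-presentably carried ones, built as colimits of `ω`-chains.
--
-- Claim 1: an fg carrier `X` is a strong quotient of an fp projective `P`, and `P ⟶ X ⟶ HX` lifts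
-- along the strong epi `HP ⟶ HX`.
--
-- Claim 2: the image `I` of `ϱH ⟶ νH` is a coalgebra, since `H` preserves the mono `I ⟶ νH` unless
-- `I` is strict initial. It is lfg because it is the directed union of the images of fp-carried
-- coalgebras. It is final because each element of an lfg coalgebra lies in an fg-carried one, which
-- by claim 1 is covered by an fp-carried one; that one maps to `ϱH`, so a diagonal fill-in lands in
-- `I`.

universe w

namespace LocFin

variable {C : Type u} [Category.{v} C]

/-! ### Colimits of coalgebras -/

section Colimits

variable {H : C ⥤ C} {K : Type*} [Category* K]

/-- The diagram of carriers of a diagram of coalgebras. -/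
abbrev carrierDiagram (F : K ⥤ Endofunctor.Coalgebra H) : K ⥤ C where
  obj k := (F.obj k).V
  map f := (F.map f).f
  map_id k := by rw [F.map_id]; rfl
  map_comp f g := by rw [F.map_comp]; rfl

/-- The cocone of carriers of a cocone of coalgebras. -/
abbrev carrierCocone {F : K ⥤ Endofunctor.Coalgebra H} (c : Cocone F) :
    Cocone (carrierDiagram F) where
  pt := c.pt.V
  ι :=
    { app := fun k => (c.ι.app k).f
      naturality := fun i j f => by
        exact congrArg Endofunctor.Coalgebra.Hom.f (c.ι.naturality f) }

/-- A colimit of the carriers of a diagram of coalgebras carries a coalgebra structure. -/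
lemma exists_cocone_carrierCocone (F : K ⥤ Endofunctor.Coalgebra H)
    {c : Cocone (carrierDiagram F)} (hc : IsColimit c) :
    ∃ c' : Cocone F, carrierCocone c' = c := by
  let s : Cocone (carrierDiagram F) :=
    { pt := H.obj c.pt
      ι :=
        { app := fun k => (F.obj k).str ≫ H.map (c.ι.app k)
          naturality := fun i j f => by
            change (F.map f).f ≫ (F.obj j).str ≫ H.map (c.ι.app j) =
              ((F.obj i).str ≫ H.map (c.ι.app i)) ≫ 𝟙 _
            rw [← c.w f, H.map_comp, Category.comp_id, Endofunctor.Coalgebra.Hom.h_assoc] } }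
  exact ⟨{ pt := ⟨c.pt, hc.desc s⟩
           ι :=
            { app := fun k =>
                { f := c.ι.app k
                  h := (hc.fac s k).symm }
              naturality := fun i j f =>
                Endofunctor.Coalgebra.ext (c.ι.naturality f) } }, rfl⟩

/-- The forgetful functor from coalgebras reflects colimits. -/
lemma nonempty_isColimit_of_carrierCocone {F : K ⥤ Endofunctor.Coalgebra H} {c : Cocone F}
    (hc : IsColimit (carrierCocone c)) : Nonempty (IsColimit c) :=
  ⟨{ desc := fun s =>
      { f := hc.desc (carrierCocone s)
        h := hc.hom_ext fun k => by
          have h := (c.ι.app k).h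
          have h' := (s.ι.app k).h
          have h₁ : (c.ι.app k).f ≫ hc.desc (carrierCocone s) = (s.ι.app k).f := hc.fac _ k
          change (c.ι.app k).f ≫ c.pt.str ≫ _ = (c.ι.app k).f ≫ _ ≫ s.pt.str
          dsimp at h h'
          rw [← reassoc_of% h, ← H.map_comp, h₁, h', reassoc_of% h₁] }
     fac := fun s k => Endofunctor.Coalgebra.ext (hc.fac (carrierCocone s) k)
     uniq := fun s m hm => Endofunctor.Coalgebra.ext
      (hc.uniq (carrierCocone s) m.f fun k => congrArg Endofunctor.Coalgebra.Hom.f (hm k)) }⟩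

/-- The coalgebras whose carrier is `κ`-presentable. -/
def presentableCarried (H : C ⥤ C) (κ : Cardinal.{v}) [Fact κ.IsRegular] :
    ObjectProperty (Endofunctor.Coalgebra H) :=
  fun A => IsCardinalPresentable A.V κ

/-- A homomorphism from a `κ`-presentable coalgebra into a `κ`-filtered colimit of coalgebras
factorizes through a member of the diagram. -/
lemma exists_hom_of_isColimit_carrierCocone {κ : Cardinal.{v}} [Fact κ.IsRegular]
    [H.IsCardinalAccessible κ]
    {J : Type v} [SmallCategory J] [IsCardinalFiltered J κ]
    {F : J ⥤ Endofunctor.Coalgebra H} {c : Cocone F} (hc : IsColimit (carrierCocone c))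
    {P : Endofunctor.Coalgebra H} (hP : presentableCarried H κ P) (h : P ⟶ c.pt) :
    ∃ (k : J) (g : P ⟶ F.obj k), h = g ≫ c.ι.app k := by
  have : IsCardinalPresentable P.V κ := hP
  obtain ⟨j, g, hg⟩ : ∃ (j : J) (g : P.V ⟶ (F.obj j).V), g ≫ (c.ι.app j).f = h.f :=
    IsCardinalPresentable.exists_hom_of_isColimit κ hc h.f
  have := H.preservesColimitsOfShape_of_isCardinalAccessible κ J
  -- `g` need not be a homomorphism, but the square commutes in `H` of the colimit, hence already at
  -- a later stage `k`.
  obtain ⟨k, a, ha⟩ : ∃ (k : J) (a : j ⟶ k),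
      (P.str ≫ H.map g) ≫ H.map (F.map a).f = (g ≫ (F.obj j).str) ≫ H.map (F.map a).f :=
    IsCardinalPresentable.exists_eq_of_isColimit' κ
    (isColimitOfPreserves H hc) (i := j) (P.str ≫ H.map g) (g ≫ (F.obj j).str) (by
      have h₁ := h.h
      have h₂ := (c.ι.app j).h
      change (P.str ≫ H.map g) ≫ H.map (c.ι.app j).f =
        (g ≫ (F.obj j).str) ≫ H.map (c.ι.app j).f
      dsimp at h₂
      rw [Category.assoc, Category.assoc, ← H.map_comp, hg, h₁, h₂, reassoc_of% hg])
  refine ⟨k,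
    { f := g ≫ (F.map a).f
      h := by
        rw [H.map_comp, ← Category.assoc, ha, Category.assoc, (F.map a).h, Category.assoc] },
    Endofunctor.Coalgebra.ext ?_⟩
  have := congrArg Endofunctor.Coalgebra.Hom.f (c.w a)
  dsimp at this ⊢
  rw [← hg, ← this, Category.assoc]

end Colimits

/-! ### The colimit of all presentably carried coalgebras -/

section Presentable

variable (H : C ⥤ C) (κ : Cardinal.{v}) [Fact κ.IsRegular] [IsCardinalLocallyPresentable C κ]

lemma exists_presentableCarried_cocone {K : Type*} [Category* K] [HasColimitsOfShape K C]
    [HasLimitsOfShape Kᵒᵖ (Type v)]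
    (F : K ⥤ Endofunctor.Coalgebra H) (hK : HasCardinalLT (Arrow K) κ)
    (hF : ∀ k, presentableCarried H κ (F.obj k)) :
    ∃ c : Cocone F, Nonempty (IsColimit c) ∧ presentableCarried H κ c.pt := by
  have : ∀ k, IsCardinalPresentable ((carrierDiagram F).obj k) κ := hF
  obtain ⟨c, hc⟩ := exists_cocone_carrierCocone F (colimit.isColimit (carrierDiagram F))
  have hc' : IsColimit (carrierCocone c) := hc ▸ colimit.isColimit (carrierDiagram F)
  exact ⟨c, nonempty_isColimit_of_carrierCocone hc',
    isCardinalPresentable_of_isColimit _ hc' κ hK⟩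

/-- A small family representing all coalgebras with `κ`-presentable carrier. -/
lemma exists_small_presentableCarried :
    ∃ (ι : Type v) (s : ι → Endofunctor.Coalgebra H),
      (∀ i, presentableCarried H κ (s i)) ∧
      ∀ A, presentableCarried H κ A → ∃ i, Nonempty (A ≅ s i) := by
  obtain ⟨Q, _, hQ, hQ'⟩ :=
    ObjectProperty.EssentiallySmall.exists_small_le.{v} (isCardinalPresentable C κ)
  let e := equivShrink.{v} (Subtype Q)
  refine ⟨Σ q : Shrink.{v} (Subtype Q), ((e.symm q).1 ⟶ H.obj (e.symm q).1),
    fun p => ⟨_, p.2⟩, fun p => hQ _ (e.symm p.1).2, fun A hA => ?_⟩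
  obtain ⟨Y, hY, ⟨f⟩⟩ := hQ' _ hA
  obtain ⟨q, hq⟩ := e.symm.surjective ⟨Y, hY⟩
  obtain rfl : Y = (e.symm q).1 := by rw [hq]
  exact ⟨⟨q, f.inv ≫ A.str ≫ H.map f.hom⟩, ⟨Endofunctor.Coalgebra.isoMk f (by simp)⟩⟩

/-- The colimit of all coalgebras with `κ`-presentable carrier. -/
lemma exists_colimit_presentableCarried [H.IsCardinalAccessible κ] :
    ∃ (J : Type v) (_ : SmallCategory J) (_ : IsCardinalFiltered J κ)
      (F : J ⥤ Endofunctor.Coalgebra H) (c : Cocone F),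
      Nonempty (IsColimit (carrierCocone c)) ∧
      (∀ j, presentableCarried H κ (F.obj j)) ∧
      ∀ P, presentableCarried H κ P → Nonempty (Unique (P ⟶ c.pt)) := by
  obtain ⟨ι, s, hs, hs'⟩ := exists_small_presentableCarried H κ
  let J := InducedCategory (Endofunctor.Coalgebra H) s
  let F : J ⥤ Endofunctor.Coalgebra H := inducedFunctor s
  -- A `κ`-small diagram has a colimit with `κ`-presentable carrier, which is isomorphic to a member
  -- of the family.
  have hJ : IsCardinalFiltered J κ := ⟨fun {A} _ K hA => by
    obtain ⟨c, -, hc⟩ := exists_presentableCarried_cocone H κ (K ⋙ F) hA (fun k => hs _)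
    obtain ⟨i, ⟨e⟩⟩ := hs' _ hc
    exact ⟨{ pt := (i : J)
             ι := { app := fun a => InducedCategory.homMk (c.ι.app a ≫ e.hom)
                    naturality := fun a b f => by
                      ext1
                      exact (c.extend e.hom).ι.naturality f } }⟩⟩
  have hJ' := isFiltered_of_isCardinalFiltered J κ
  obtain ⟨c, hc⟩ := exists_cocone_carrierCocone F (colimit.isColimit (carrierDiagram F))
  have hc' : IsColimit (carrierCocone c) := hc ▸ colimit.isColimit (carrierDiagram F)
  refine ⟨J, inferInstance, hJ, F, c, ⟨hc'⟩, hs, fun P hP => ?_⟩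
  obtain ⟨i, ⟨e⟩⟩ := hs' _ hP
  refine ⟨⟨⟨e.hom ≫ c.ι.app (i : J)⟩, fun h => ?_⟩⟩
  obtain ⟨k, g, rfl⟩ := exists_hom_of_isColimit_carrierCocone hc' hP h
  let i' : J := i
  -- `J` is full, so `g` is itself a transition morphism of the diagram; this yields uniqueness.
  let φ : i' ⟶ k := InducedCategory.homMk (e.inv ≫ g)
  change g ≫ c.ι.app k = e.hom ≫ c.ι.app i'
  rw [← c.w φ]
  change g ≫ c.ι.app k = e.hom ≫ (e.inv ≫ g) ≫ c.ι.app k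
  rw [Category.assoc, e.hom_inv_id_assoc]

end Presentable

lemma hasCardinalLT_of_countable {κ : Cardinal.{v}} (hκ : Cardinal.aleph0 < κ)
    (T : Type w) [Countable T] : HasCardinalLT T κ := by
  have h : Cardinal.lift.{v} (Cardinal.mk T) ≤ Cardinal.aleph0 := by simp
  refine lt_of_le_of_lt h ?_
  simpa using Cardinal.lift_lt.{v, w}.2 hκ

instance countable_arrow_nat : Countable (Arrow ℕ) :=
  Function.Injective.countable (f := fun f : Arrow ℕ => (f.left, f.right)) (by
    rintro ⟨a, b, f⟩ ⟨a', b', f'⟩ h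
    obtain ⟨rfl, rfl⟩ : a = a' ∧ b = b' := by simpa using h
    exact congrArg (Arrow.mk (T := ℕ)) (Subsingleton.elim (α := a ⟶ b) f f'))

/-! ### Completing partial coalgebras along chains -/

section Chain

variable {H : C ⥤ C} {κ : Cardinal.{v}} [Fact κ.IsRegular]

/-- Partial coalgebra structures over a coalgebra `A`: a morphism `t : V ⟶ W` over the carrier
of `A`, together with a map `V ⟶ H W` compatible with the structure of `A`. -/
structure PartialCoalgebra (A : Endofunctor.Coalgebra H) (κ : Cardinal.{v}) [Fact κ.IsRegular] where
  /-- the domain -/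
  V : C
  /-- the codomain -/
  W : C
  /-- the transition map -/
  t : V ⟶ W
  /-- the map to the carrier -/
  w : W ⟶ A.V
  /-- the partial structure -/
  s : V ⟶ H.obj W
  hV : IsCardinalPresentable V κ
  hW : IsCardinalPresentable W κ
  comm : s ≫ H.map w = t ≫ w ≫ A.str

/-- `H` preserves a presentation of `A.V` as a `κ`-filtered colimit of `κ`-presentables, so `w` and
`w ≫ A.str` both factor through stages. The compatibility with `X.s` holds over `A` by `comm`, hence
at a later stage. -/
lemma PartialCoalgebra.exists_next [IsCardinalLocallyPresentable C κ] [H.IsCardinalAccessible κ]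
    {A : Endofunctor.Coalgebra H} (X : PartialCoalgebra A κ) :
    ∃ (W' : C) (t' : X.W ⟶ W') (w' : W' ⟶ A.V) (s' : X.W ⟶ H.obj W'),
      IsCardinalPresentable W' κ ∧ t' ≫ w' = X.w ∧ s' ≫ H.map w' = X.w ≫ A.str ∧
      X.t ≫ s' = X.s ≫ H.map t' := by
  obtain ⟨J, _, _, ⟨p⟩⟩ :=
    (isCardinalFilteredGenerator_isCardinalPresentable C κ).exists_colimitsOfShape A.V
  have := isFiltered_of_isCardinalFiltered J κ
  have := X.hV
  have := X.hW
  have := H.preservesColimitsOfShape_of_isCardinalAccessible κ J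
  have hp := isColimitOfPreserves H p.isColimit
  have hw : ∀ {i j : J} (a : i ⟶ j), p.diag.map a ≫ p.ι.app j = p.ι.app i := fun a =>
    (p.ι.naturality a).trans (Category.comp_id _)
  obtain ⟨j₀, w₀, hw₀⟩ : ∃ (j : J) (w₀ : X.W ⟶ p.diag.obj j), w₀ ≫ p.ι.app j = X.w :=
    IsCardinalPresentable.exists_hom_of_isColimit κ p.isColimit X.w
  obtain ⟨j₁, s₁, hs₁⟩ : ∃ (j : J) (s₁ : X.W ⟶ H.obj (p.diag.obj j)),
      s₁ ≫ H.map (p.ι.app j) = X.w ≫ A.str :=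
    IsCardinalPresentable.exists_hom_of_isColimit κ hp (X.w ≫ A.str)
  obtain ⟨j, a, b, h⟩ : ∃ (j : J) (a : j₀ ⟶ j) (b : j₁ ⟶ j),
      (X.s ≫ H.map w₀) ≫ H.map (p.diag.map a) = (X.t ≫ s₁) ≫ H.map (p.diag.map b) :=
    IsCardinalPresentable.exists_eq_of_isColimit κ hp (i₁ := j₀) (i₂ := j₁)
      (X.s ≫ H.map w₀) (X.t ≫ s₁) (by
        change (X.s ≫ H.map w₀) ≫ H.map (p.ι.app j₀) = (X.t ≫ s₁) ≫ H.map (p.ι.app j₁)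
        rw [Category.assoc, Category.assoc, ← H.map_comp, hw₀, hs₁, X.comm])
  refine ⟨p.diag.obj j, w₀ ≫ p.diag.map a, p.ι.app j, s₁ ≫ H.map (p.diag.map b),
    p.prop_diag_obj j, ?_, ?_, ?_⟩
  · rw [Category.assoc, hw, hw₀]
  · rw [Category.assoc, ← H.map_comp, hw, hs₁]
  · rw [← Category.assoc, ← h, Category.assoc, H.map_comp]

/-- A chosen extension of a partial coalgebra structure. -/
noncomputable def PartialCoalgebra.next [IsCardinalLocallyPresentable C κ]
    [H.IsCardinalAccessible κ] {A : Endofunctor.Coalgebra H} (X : PartialCoalgebra A κ) :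
    PartialCoalgebra A κ where
  V := X.W
  W := X.exists_next.choose
  t := X.exists_next.choose_spec.choose
  w := X.exists_next.choose_spec.choose_spec.choose
  s := X.exists_next.choose_spec.choose_spec.choose_spec.choose
  hV := X.hW
  hW := X.exists_next.choose_spec.choose_spec.choose_spec.choose_spec.1
  comm := by
    obtain ⟨-, h₁, h₂, -⟩ := X.exists_next.choose_spec.choose_spec.choose_spec.choose_spec
    rw [h₂, reassoc_of% h₁]

/-- The iterated extensions of a partial coalgebra structure. -/
noncomputable def PartialCoalgebra.iterate [IsCardinalLocallyPresentable C κ]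
    [H.IsCardinalAccessible κ] {A : Endofunctor.Coalgebra H} (X : PartialCoalgebra A κ) :
    ℕ → PartialCoalgebra A κ
  | 0 => X
  | n + 1 => (X.iterate n).next

/-- A partial coalgebra structure over `A` extends to a coalgebra over `A`
with `κ`-presentable carrier. -/
lemma PartialCoalgebra.exists_coalgebra [IsCardinalLocallyPresentable C κ]
    [H.IsCardinalAccessible κ] (hκ : Cardinal.aleph0 < κ)
    {A : Endofunctor.Coalgebra H} (X : PartialCoalgebra A κ) :
    ∃ (Q : Endofunctor.Coalgebra H) (k : Q ⟶ A) (g : X.W ⟶ Q.V),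
      presentableCarried H κ Q ∧ g ≫ k.f = X.w ∧ X.s ≫ H.map g = X.t ≫ g ≫ Q.str := by
  let V (n : ℕ) : C := (X.iterate n).V
  let t (n : ℕ) : V n ⟶ V (n + 1) := (X.iterate n).t
  let s (n : ℕ) : V n ⟶ H.obj (V (n + 1)) := (X.iterate n).s
  let w (n : ℕ) : V (n + 1) ⟶ A.V := (X.iterate n).w
  have htw (n : ℕ) : t (n + 1) ≫ w (n + 1) = w n :=
    (X.iterate n).exists_next.choose_spec.choose_spec.choose_spec.choose_spec.2.1
  have hts (n : ℕ) : t n ≫ s (n + 1) = s n ≫ H.map (t (n + 1)) :=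
    (X.iterate n).exists_next.choose_spec.choose_spec.choose_spec.choose_spec.2.2.2
  have hsw (n : ℕ) : s n ≫ H.map (w n) = t n ≫ w n ≫ A.str := (X.iterate n).comm
  have : HasColimitsOfSize.{0, 0} C := hasColimitsOfSizeShrink.{0, 0, v, v} C
  let F : ℕ ⥤ C := Functor.ofSequence t
  let c := colimit.cocone F
  let hc : IsColimit c := colimit.isColimit F
  let i (n : ℕ) : V n ⟶ c.pt := c.ι.app n
  have hi (n : ℕ) : t n ≫ i (n + 1) = i n := by
    have := c.w (homOfLE (Nat.le_add_right n 1))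
    rwa [Functor.ofSequence_map_homOfLE_succ] at this
  have hs (n : ℕ) : t n ≫ s (n + 1) ≫ H.map (i (n + 2)) = s n ≫ H.map (i (n + 1)) := by
    rw [← hi (n + 1), H.map_comp, ← Category.assoc, hts, Category.assoc]
  have htw' (n : ℕ) : t n ≫ t (n + 1) ≫ w (n + 1) = t n ≫ w n := by rw [htw]
  -- The structure on stage `n` lands in `H` of stage `n + 1`; the shift disappears in the colimit.
  let S : Cocone F :=
    { pt := H.obj c.pt
      ι := NatTrans.ofSequence (G := (Functor.const ℕ).obj (H.obj c.pt))
        (fun n => (s n ≫ H.map (i (n + 1)) : V n ⟶ H.obj c.pt)) (fun n => by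
          rw [Functor.ofSequence_map_homOfLE_succ]
          exact (hs n).trans (Category.comp_id _).symm) }
  let B : Cocone F :=
    { pt := A.V
      ι := NatTrans.ofSequence (G := (Functor.const ℕ).obj A.V)
        (fun n => (t n ≫ w n : V n ⟶ A.V)) (fun n => by
          rw [Functor.ofSequence_map_homOfLE_succ]
          exact (htw' n).trans (Category.comp_id _).symm) }
  have hS (n : ℕ) : i n ≫ hc.desc S = s n ≫ H.map (i (n + 1)) := hc.fac S n
  have hB (n : ℕ) : i n ≫ hc.desc B = t n ≫ w n := hc.fac B n
  have hV (n : ℕ) : IsCardinalPresentable (F.obj n) κ := (X.iterate n).hV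
  -- `X.W` is `V 1`, whence `i 1`. Uncountability of `κ` keeps the colimit of the chain
  -- `κ`-presentable.
  refine ⟨⟨c.pt, hc.desc S⟩, ⟨hc.desc B, hc.hom_ext fun n => ?_⟩, i 1,
    isCardinalPresentable_of_isColimit c hc κ (hasCardinalLT_of_countable hκ _), ?_, ?_⟩
  · change i n ≫ hc.desc S ≫ _ = i n ≫ hc.desc B ≫ _
    rw [reassoc_of% hS, reassoc_of% hB, ← H.map_comp, hB, htw, hsw]
  · exact (hB 1).trans (htw 0)
  · change s 0 ≫ H.map (i 1) = t 0 ≫ i 1 ≫ hc.desc S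
    rw [reassoc_of% (hi 0), hS]

end Chain

/-! ### Existence of the final coalgebra -/

section Terminal

variable {H : C ⥤ C} {κ : Cardinal.{v}} [Fact κ.IsRegular] [IsCardinalLocallyPresentable C κ]
  [H.IsCardinalAccessible κ]

/-- Every morphism from a `κ`-presentable object to the carrier of a coalgebra factorizes through
a coalgebra with `κ`-presentable carrier, if `κ` is uncountable. -/
lemma exists_presentableCarried_factorization (hκ : Cardinal.aleph0 < κ)
    {A : Endofunctor.Coalgebra H} {W : C} [hW : IsCardinalPresentable W κ] (w : W ⟶ A.V) :
    ∃ (Q : Endofunctor.Coalgebra H) (k : Q ⟶ A) (g : W ⟶ Q.V),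
      presentableCarried H κ Q ∧ g ≫ k.f = w := by
  have : ∀ k, IsCardinalPresentable ((Functor.empty.{0} C).obj k) κ := fun k => k.as.elim
  have : HasColimitsOfSize.{0, 0} C := hasColimitsOfSizeShrink.{0, 0, v, v} C
  -- With initial domain, a partial structure carries no data beyond `w`.
  obtain ⟨Q, k, g, hQ, hg, -⟩ := PartialCoalgebra.exists_coalgebra hκ (A := A)
    { V := ⊥_ C
      W := W
      t := initial.to _
      w := w
      s := initial.to _
      hV := isCardinalPresentable_of_isColimit _ (colimit.isColimit (Functor.empty.{0} C)) κ
        (hasCardinalLT_of_countable hκ _)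
      hW := hW
      comm := initial.hom_ext _ _ }
  exact ⟨Q, k, g, hQ, hg⟩

/-- The coequalizer of `x` and `y` in `P + Q` need not be a coalgebra, but the structure of `P + Q`
makes it a partial one over `A`, which can be completed. -/
lemma exists_presentableCarried_merge (hκ : Cardinal.aleph0 < κ)
    {A P Q : Endofunctor.Coalgebra H} (hP : presentableCarried H κ P)
    (hQ : presentableCarried H κ Q) (h : P ⟶ A) (k : Q ⟶ A)
    {G : C} [IsCardinalPresentable G κ] (x : G ⟶ P.V) (y : G ⟶ Q.V) (hxy : x ≫ h.f = y ≫ k.f) :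
    ∃ (M : Endofunctor.Coalgebra H) (a : P ⟶ M) (b : Q ⟶ M),
      presentableCarried H κ M ∧ x ≫ a.f = y ≫ b.f := by
  have : HasColimitsOfSize.{0, 0} C := hasColimitsOfSizeShrink.{0, 0, v, v} C
  obtain ⟨c, ⟨hc⟩, hS⟩ := exists_presentableCarried_cocone H κ (pair P Q)
    (hasCardinalLT_of_countable hκ _) (by rintro (_ | _) <;> assumption)
  let inl : P ⟶ c.pt := c.ι.app ⟨.left⟩
  let inr : Q ⟶ c.pt := c.ι.app ⟨.right⟩
  let d : c.pt ⟶ A := hc.desc (BinaryCofan.mk h k)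
  have hl : inl.f ≫ d.f = h.f := congrArg (·.f) (hc.fac (BinaryCofan.mk h k) ⟨.left⟩)
  have hr : inr.f ≫ d.f = k.f := congrArg (·.f) (hc.fac (BinaryCofan.mk h k) ⟨.right⟩)
  let w : coequalizer (x ≫ inl.f) (y ≫ inr.f) ⟶ A.V := coequalizer.desc d.f (by
    rw [Category.assoc, Category.assoc, hl, hr, hxy])
  let π : c.pt.V ⟶ coequalizer (x ≫ inl.f) (y ≫ inr.f) := coequalizer.π _ _
  have hπ : π ≫ w = d.f := coequalizer.π_desc _ _
  have hc' : IsCardinalPresentable c.pt.V κ := hS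
  have : ∀ j, IsCardinalPresentable ((parallelPair (x ≫ inl.f) (y ≫ inr.f)).obj j) κ := by
    rintro (_ | _) <;> assumption
  obtain ⟨M, m, g, hM, -, hg⟩ := PartialCoalgebra.exists_coalgebra hκ (A := A)
    { V := c.pt.V
      W := coequalizer (x ≫ inl.f) (y ≫ inr.f)
      t := π
      w := w
      s := c.pt.str ≫ H.map π
      hV := hS
      hW := isCardinalPresentable_of_isColimit _
        (colimit.isColimit (parallelPair (x ≫ inl.f) (y ≫ inr.f))) κ
        (hasCardinalLT_of_countable hκ _)
      comm := by rw [Category.assoc, ← H.map_comp, reassoc_of% hπ, hπ, d.h] }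
  let l : c.pt ⟶ M :=
    { f := π ≫ g
      h := by
        have hg' : (c.pt.str ≫ H.map π) ≫ H.map g = π ≫ g ≫ M.str := hg
        rw [H.map_comp, ← Category.assoc, hg', Category.assoc] }
  refine ⟨M, inl ≫ l, inr ≫ l, hM, ?_⟩
  change x ≫ inl.f ≫ π ≫ g = y ≫ inr.f ≫ π ≫ g
  have := coequalizer.condition (x ≫ inl.f) (y ≫ inr.f)
  simp only [Category.assoc] at this
  rw [reassoc_of% this]

/-- A coalgebra with a unique homomorphism from every coalgebra with `κ`-presentable carrier
is terminal, if `κ` is uncountable. -/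
lemma nonempty_isTerminal_of_presentableCarried (hκ : Cardinal.aleph0 < κ)
    {T : Endofunctor.Coalgebra H}
    (hT : ∀ P, presentableCarried H κ P → Nonempty (Unique (P ⟶ T))) :
    Nonempty (IsTerminal T) := by
  have hT' (P : Endofunctor.Coalgebra H) (hP : presentableCarried H κ P) :
      ∃ f : P ⟶ T, ∀ g, g = f := by
    obtain ⟨⟨f⟩, hf⟩ := hT P hP
    exact ⟨f, hf⟩
  choose u hu using hT'
  suffices h : ∀ A : Endofunctor.Coalgebra H, Nonempty (Unique (A ⟶ T)) by
    exact ⟨IsTerminal.ofUniqueHom (fun A => (h A).some.default)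
      fun A f => (h A).some.uniq f⟩
  intro A
  obtain ⟨J, _, _, ⟨p⟩⟩ :=
    (isCardinalFilteredGenerator_isCardinalPresentable C κ).exists_colimitsOfShape A.V
  have hp (j : J) : IsCardinalPresentable (p.diag.obj j) κ := p.prop_diag_obj j
  -- Well-definedness: the induced map to `T` does not depend on the presentable coalgebra chosen
  -- over `A`, since two choices merge into `M` and homomorphisms to `T` are unique.
  have wd {P Q : Endofunctor.Coalgebra H} (hP : presentableCarried H κ P)
      (hQ : presentableCarried H κ Q) (h : P ⟶ A) (k : Q ⟶ A)
      {G : C} [IsCardinalPresentable G κ] (x : G ⟶ P.V) (y : G ⟶ Q.V)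
      (hxy : x ≫ h.f = y ≫ k.f) : x ≫ (u P hP).f = y ≫ (u Q hQ).f := by
    obtain ⟨M, a, b, hM, hab⟩ := exists_presentableCarried_merge hκ hP hQ h k x y hxy
    rw [← hu P hP (a ≫ u M hM), ← hu Q hQ (b ≫ u M hM)]
    change x ≫ a.f ≫ _ = y ≫ b.f ≫ _
    rw [reassoc_of% hab]
  choose Q k g hQ hg using fun j : J =>
    exists_presentableCarried_factorization hκ (A := A) (p.ι.app j)
  let B : Cocone p.diag :=
    { pt := T.V
      ι :=
        { app := fun j => g j ≫ (u (Q j) (hQ j)).f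
          naturality := fun i j a => by
            refine Eq.trans ?_ (Category.comp_id _).symm
            rw [← Category.assoc]
            refine wd _ _ (k j) (k i) _ _ ?_
            rw [Category.assoc, hg, hg]
            exact (p.ι.naturality a).trans (Category.comp_id _) } }
  let d : A.V ⟶ T.V := p.isColimit.desc B
  have hd (j : J) : p.ι.app j ≫ d = g j ≫ (u (Q j) (hQ j)).f := p.isColimit.fac B j
  have hd' {P : Endofunctor.Coalgebra H} (hP : presentableCarried H κ P) (h : P ⟶ A) :
      h.f ≫ d = (u P hP).f := by
    have : IsCardinalPresentable P.V κ := hP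
    obtain ⟨j, y, hy⟩ : ∃ (j : J) (y : P.V ⟶ p.diag.obj j), y ≫ p.ι.app j = h.f :=
      IsCardinalPresentable.exists_hom_of_isColimit κ p.isColimit h.f
    rw [← hy, Category.assoc, hd, ← Category.assoc, wd (hQ j) hP (k j) h _ (𝟙 _) (by
      rw [Category.assoc, hg, hy, Category.id_comp]), Category.id_comp]
  have he {X : C} (f f' : A.V ⟶ X) (hf : ∀ (P : Endofunctor.Coalgebra H) (h : P ⟶ A),
      presentableCarried H κ P → h.f ≫ f = h.f ≫ f') : f = f' := by
    refine p.isColimit.hom_ext fun j => ?_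
    change p.ι.app j ≫ f = p.ι.app j ≫ f'
    rw [← hg, Category.assoc, Category.assoc, hf _ _ (hQ j)]
  refine ⟨⟨⟨⟨d, he _ _ fun P h hP => ?_⟩⟩, fun f => Endofunctor.Coalgebra.ext
    (he _ _ fun P h hP => ?_)⟩⟩
  · rw [← Endofunctor.Coalgebra.Hom.h_assoc, ← H.map_comp, hd' hP h, ← Category.assoc, hd' hP h]
    exact (u P hP).h
  · change (h ≫ f).f = h.f ≫ d
    rw [hu P hP (h ≫ f), hd' hP h]

end Terminal

/-- A finitary endofunctor of a locally finitely presentable category has a final coalgebra. -/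
theorem exists_isTerminal_coalgebra [IsLocallyFinitelyPresentable.{v} C] (H : C ⥤ C)
    [PreservesFilteredColimits H] : ∃ N : Endofunctor.Coalgebra H, Nonempty (IsTerminal N) := by
  have : Fact (Cardinal.aleph.{v} 1).IsRegular := ⟨Cardinal.isRegular_aleph_one⟩
  have := Cardinal.fact_isRegular_aleph0
  have : H.IsFinitelyAccessible :=
    Functor.isFinitelyAccessible_iff_preservesFilteredColimits.2 inferInstance
  -- `ℵ₁` is the least uncountable choice; the `ω`-chains rule out `ℵ₀`.
  have h : Cardinal.aleph0.{v} < Cardinal.aleph 1 := Cardinal.aleph0_lt_aleph_one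
  have := IsCardinalLocallyPresentable.of_le C h.le
  have := H.isCardinalAccessible_of_le h.le
  obtain ⟨J, _, _, F, c, -, -, hc⟩ := exists_colimit_presentableCarried H (Cardinal.aleph.{v} 1)
  exact ⟨c.pt, nonempty_isTerminal_of_presentableCarried h hc⟩

/-! ### Projective generators and images -/

/-- A small family of finitely presentable objects, projective with respect to strong
epimorphisms, which is separating and detects that a monomorphism is an isomorphism. -/
structure IsProjectiveGenerator {ι : Type v} (G : ι → C) : Prop where
  presentable (i : ι) : IsFinitelyPresentable.{v} (G i)
  projective (i : ι) : IsStrongProjective (G i)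
  hom_ext {X Y : C} (f g : X ⟶ Y) (h : ∀ (i : ι) (x : G i ⟶ X), x ≫ f = x ≫ g) : f = g
  isIso_of_mono {X Y : C} (m : X ⟶ Y) [Mono m]
    (h : ∀ (i : ι) (y : G i ⟶ Y), ∃ x : G i ⟶ X, x ≫ m = y) : IsIso m

/-- Covering a strong generator by fp projectives keeps its properties: equalities cancel along the
epis, and factorizations through a mono descend by diagonal fill-in. -/
lemma exists_isProjectiveGenerator [IsLocallyFinitelyPresentable.{v} C]
    (hproj : ∀ X : C, IsFinitelyPresentable.{v} X →
      ∃ P : C, IsFinitelyPresentable.{v} P ∧ IsStrongProjective P ∧ IsStrongQuotientOf X P) :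
    ∃ (ι : Type v) (G : ι → C), IsProjectiveGenerator G := by
  have := Cardinal.fact_isRegular_aleph0
  obtain ⟨Q, _, hQ⟩ :=
    HasCardinalFilteredGenerator.exists_small_generator C Cardinal.aleph0.{v}
  have hS := hQ.isStrongGenerator
  let e := equivShrink.{v} (Subtype Q)
  choose P hP hP' q hq using fun i : Shrink.{v} (Subtype Q) =>
    hproj (e.symm i).1 (hQ.le_isCardinalPresentable _ (e.symm i).2)
  refine ⟨Shrink.{v} (Subtype Q), P, hP, hP', fun f g h => ?_, fun m _ h => ?_⟩
  · refine hS.isSeparating _ _ fun X hX x => ?_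
    obtain ⟨i, hi⟩ := e.symm.surjective ⟨X, hX⟩
    obtain rfl : X = (e.symm i).1 := by rw [hi]
    rw [← cancel_epi (q i), ← Category.assoc, ← Category.assoc, h]
  · refine hS.isIso_of_mono m fun X hX y => ?_
    obtain ⟨i, hi⟩ := e.symm.surjective ⟨X, hX⟩
    obtain rfl : X = (e.symm i).1 := by rw [hi]
    obtain ⟨x, hx⟩ := h i (q i ≫ y)
    have sq : CommSq x (q i) m y := ⟨hx⟩
    exact ⟨sq.lift, sq.fac_right⟩

namespace IsProjectiveGenerator

variable {ι : Type v} {G : ι → C} (hG : IsProjectiveGenerator G)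

include hG

/-- Every morphism factorizes as a strong epimorphism followed by a monomorphism: the strong
epimorphism coequalizes all pairs from the generator that are merged by the morphism. -/
lemma exists_strongEpi_mono_factorization [HasColimitsOfSize.{v, v} C] {X Y : C} (f : X ⟶ Y) :
    ∃ (I : C) (e : X ⟶ I) (m : I ⟶ Y), StrongEpi e ∧ Mono m ∧ e ≫ m = f := by
  have : HasColimitsOfSize.{0, 0} C := hasColimitsOfSizeShrink.{0, 0, v, v} C
  let R := Σ i : ι, { p : (G i ⟶ X) × (G i ⟶ X) // p.1 ≫ f = p.2 ≫ f }
  let a : (∐ fun r : R => G r.1) ⟶ X := Sigma.desc fun r => r.2.1.1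
  let b : (∐ fun r : R => G r.1) ⟶ X := Sigma.desc fun r => r.2.1.2
  have hab : a ≫ f = b ≫ f := by
    refine Sigma.hom_ext _ _ fun r => ?_
    rw [Sigma.ι_desc_assoc, Sigma.ι_desc_assoc, r.2.2]
  have he : StrongEpi (coequalizer.π a b) := inferInstance
  refine ⟨coequalizer a b, coequalizer.π a b, coequalizer.desc f hab, he,
    ⟨fun {Z} x y hxy => hG.hom_ext _ _ fun i z => ?_⟩, coequalizer.π_desc _ _⟩
  -- Lifted to `X`, the two elements form a pair in `R`, which the coequalizer identifies.
  obtain ⟨x', hx'⟩ := hG.projective i (coequalizer.π a b) (z ≫ x)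
  obtain ⟨y', hy'⟩ := hG.projective i (coequalizer.π a b) (z ≫ y)
  have h : x' ≫ f = y' ≫ f := by
    rw [← coequalizer.π_desc f hab, reassoc_of% hx', reassoc_of% hy', hxy]
  rw [← hx', ← hy']
  let r : R := ⟨i, ⟨(x', y'), h⟩⟩
  have hra : Sigma.ι (fun r : R => G r.1) r ≫ a = x' := Sigma.ι_desc _ _
  have hrb : Sigma.ι (fun r : R => G r.1) r ≫ b = y' := Sigma.ι_desc _ _
  rw [← hra, ← hrb, Category.assoc, Category.assoc, coequalizer.condition]

/-- A morphism is a strong epimorphism if no proper subobject of its codomain contains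
its image. -/
lemma strongEpi_of_forall_isIso [HasColimitsOfSize.{v, v} C] {X Y : C} (f : X ⟶ Y)
    (h : ∀ (I : C) (e : X ⟶ I) (m : I ⟶ Y), Mono m → e ≫ m = f → IsIso m) : StrongEpi f := by
  obtain ⟨I, e, m, he, hm, rfl⟩ := hG.exists_strongEpi_mono_factorization f
  have := h I e m hm rfl
  infer_instance

/-- Every object is covered by a coproduct of members of the generator. -/
lemma strongEpi_sigmaDesc [HasColimitsOfSize.{v, v} C] (X : C) :
    StrongEpi (Sigma.desc (fun p : Σ i, (G i ⟶ X) => p.2)) := by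
  refine hG.strongEpi_of_forall_isIso _ fun I e m _ h => hG.isIso_of_mono m fun i y => ?_
  refine ⟨Sigma.ι (fun p : Σ i, (G i ⟶ X) => G p.1) ⟨i, y⟩ ≫ e, ?_⟩
  rw [Category.assoc, h, Sigma.ι_desc]

/-- A morphism factorizes through a monomorphism as soon as all its restrictions to members of
the generator do. -/
lemma exists_lift_of_forall [HasColimitsOfSize.{v, v} C] {X Y Z : C} (f : X ⟶ Z) (m : Y ⟶ Z)
    [Mono m] (h : ∀ (i : ι) (x : G i ⟶ X), ∃ y : G i ⟶ Y, y ≫ m = x ≫ f) :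
    ∃ g : X ⟶ Y, g ≫ m = f := by
  have := hG.strongEpi_sigmaDesc X
  choose y hy using h
  have sq : CommSq (Sigma.desc fun p : Σ i, (G i ⟶ X) => y p.1 p.2)
      (Sigma.desc (fun p : Σ i, (G i ⟶ X) => p.2)) m f := ⟨by
    refine Sigma.hom_ext _ _ fun p => ?_
    rw [Sigma.ι_desc_assoc, Sigma.ι_desc_assoc, hy]⟩
  exact ⟨sq.lift, sq.fac_right⟩

/-- The morphism induced on a filtered colimit by a cocone of monomorphisms is a monomorphism. -/
lemma mono_desc {J : Type v} [SmallCategory J] [IsFiltered J] {D : J ⥤ C} {c : Cocone D}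
    (hc : IsColimit c) {Y : C} (f : c.pt ⟶ Y) (hf : ∀ j, Mono (c.ι.app j ≫ f)) : Mono f where
  right_cancellation {Z} x y hxy := hG.hom_ext _ _ fun i z => by
    have := hG.presentable i
    obtain ⟨j, x', hx'⟩ := IsFinitelyPresentable.exists_hom_of_isColimit hc (z ≫ x)
    obtain ⟨k, y', hy'⟩ := IsFinitelyPresentable.exists_hom_of_isColimit hc (z ≫ y)
    let l := IsFiltered.max j k
    let a : j ⟶ l := IsFiltered.leftToMax j k
    let b : k ⟶ l := IsFiltered.rightToMax j k
    have h : x' ≫ D.map a = y' ≫ D.map b := by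
      rw [← cancel_mono (c.ι.app l ≫ f), Category.assoc, Category.assoc, c.w_assoc, c.w_assoc,
        reassoc_of% hx', reassoc_of% hy', hxy]
    rw [← hx', ← hy', ← c.w a, ← c.w b, reassoc_of% h]

/-- The colimit injections of a filtered diagram of monomorphisms are monomorphisms. -/
lemma mono_ι_app {J : Type v} [SmallCategory J] [IsFiltered J] {D : J ⥤ C} {c : Cocone D}
    (hc : IsColimit c) (hD : ∀ ⦃i j : J⦄ (f : i ⟶ j), Mono (D.map f)) (j : J) :
    Mono (c.ι.app j) where
  right_cancellation {Z} x y hxy := hG.hom_ext _ _ fun i z => by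
    have := hG.presentable i
    obtain ⟨k, a, b, h⟩ := IsFinitelyPresentable.exists_eq_of_isColimit hc (z ≫ x) (z ≫ y)
      (by rw [Category.assoc, Category.assoc, hxy])
    have := hD a
    have := hD b
    -- The parallel arrows `a` and `b` may differ until coequalized by `d`.
    obtain ⟨l, d, hd⟩ := IsFilteredOrEmpty.cocone_maps a b
    have := hD (a ≫ d)
    rw [← cancel_mono (D.map (a ≫ d))]
    conv_rhs => rw [hd]
    rw [D.map_comp, D.map_comp, ← Category.assoc, ← Category.assoc, h]

end IsProjectiveGenerator

/-! ### Finitely generated objects -/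

lemma isFinitelyGenerated_of_isFinitelyPresentable {X : C} (hX : IsFinitelyPresentable.{v} X) :
    IsFinitelyGenerated X := by
  intro I _ _ _ D _
  infer_instance

/-- A strong quotient of a finitely generated object is finitely generated. -/
lemma IsProjectiveGenerator.isFinitelyGenerated_of_strongEpi {ι : Type v} {G : ι → C}
    (hG : IsProjectiveGenerator G) {X Y : C} (hX : IsFinitelyGenerated X)
    (e : X ⟶ Y) [StrongEpi e] : IsFinitelyGenerated Y := by
  intro I _ _ _ D hD
  have := hX I D hD
  refine ⟨fun {c} hc => ⟨?_⟩⟩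
  have hm := hG.mono_ι_app hc hD
  refine Types.FilteredColimit.isColimitOf' _ _ (fun f => ?_) (fun i x y h => ?_)
  -- Factorize on `X` first; the fill-in of `e` against the monic injection descends to `Y`.
  · obtain ⟨i, g, hg⟩ := exists_hom_of_preservesColimit_coyoneda hc (e ≫ (f : Y ⟶ c.pt))
    have sq : CommSq g e (c.ι.app i) f := ⟨hg⟩
    exact ⟨i, sq.lift, sq.fac_right.symm⟩
  · exact ⟨i, 𝟙 i, by rw [(cancel_mono (c.ι.app i)).1 h]⟩

/-- Let `φ` be a strong epimorphism from a filtered colimit. Then its codomain is the union of the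
images of the members of the diagram: every morphism from a finitely generated object
factorizes through one of them. -/
lemma IsProjectiveGenerator.exists_factorization_through_image [HasColimitsOfSize.{v, v} C]
    {ι : Type v} {G : ι → C} (hG : IsProjectiveGenerator G)
    {J : Type v} [SmallCategory J] [IsFiltered J] {D : J ⥤ C} {c : Cocone D} (hc : IsColimit c)
    {Y : C} (φ : c.pt ⟶ Y) [StrongEpi φ] (I : J → C) (e : ∀ j, D.obj j ⟶ I j)
    (m : ∀ j, I j ⟶ Y) (he : ∀ j, StrongEpi (e j)) (hm : ∀ j, Mono (m j))
    (hem : ∀ j, e j ≫ m j = c.ι.app j ≫ φ) {S : C} (hS : IsFinitelyGenerated S) (f : S ⟶ Y) :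
    ∃ (j : J) (g : S ⟶ I j), g ≫ m j = f := by
  -- Finite generation speaks of directed posets only, so a final one replaces `J`.
  obtain ⟨α, _, _, _, F, _⟩ := IsFiltered.exists_directed J
  have sq {i j : J} (a : i ⟶ j) : CommSq (D.map a ≫ e j) (e i) (m j) (m i) :=
    ⟨by rw [Category.assoc, hem, hem, c.w_assoc]⟩
  let E : α ⥤ C :=
    { obj := fun a => I (F.obj a)
      map := fun f => (sq (F.map f)).lift
      map_id := fun a => by
        rw [← cancel_mono (m (F.obj a)), CommSq.fac_right, Category.id_comp]
      map_comp := fun {a b d} f g => by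
        rw [← cancel_mono (m (F.obj d)), CommSq.fac_right, Category.assoc, CommSq.fac_right,
          CommSq.fac_right] }
  let s : Cocone E :=
    { pt := Y
      ι := { app := fun a => m (F.obj a)
             naturality := fun a b f =>
              ((sq (F.map f)).fac_right).trans (Category.comp_id _).symm } }
  have hE : ∀ ⦃a b : α⦄ (f : a ⟶ b), Mono (E.map f) := fun a b f => by
    have h : E.map f ≫ m (F.obj b) = m (F.obj a) := (sq (F.map f)).fac_right
    have : Mono (E.map f ≫ m (F.obj b)) := by rw [h]; infer_instance
    exact mono_of_mono _ (m (F.obj b))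
  have := hS α E hE
  let d : colimit E ⟶ Y := colimit.desc E s
  have hd (a : α) : colimit.ι E a ≫ d = m (F.obj a) := colimit.ι_desc s a
  have : Mono d := hG.mono_desc (colimit.isColimit E) d fun a => by
    change Mono (colimit.ι E a ≫ d)
    rw [hd]
    infer_instance
  have hc' : IsColimit (c.whisker F) := (Functor.Final.isColimitWhiskerEquiv F c).symm hc
  let r : Cocone (F ⋙ D) :=
    { pt := colimit E
      ι := { app := fun a => e (F.obj a) ≫ colimit.ι E a
             naturality := fun a b f => by
              refine Eq.trans ?_ (Category.comp_id _).symm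
              change D.map (F.map f) ≫ e (F.obj b) ≫ colimit.ι E b =
                e (F.obj a) ≫ colimit.ι E a
              rw [← (cancel_mono d), Category.assoc, Category.assoc, Category.assoc, hd, hd, hem,
                hem, c.w_assoc] } }
  -- The strong epi `φ` factors through the mono `d`, which is therefore an isomorphism.
  let t : c.pt ⟶ colimit E := hc'.desc r
  have ht : t ≫ d = φ := hc'.hom_ext fun a => by
    have h : c.ι.app (F.obj a) ≫ t = e (F.obj a) ≫ colimit.ι E a := hc'.fac r a
    change c.ι.app (F.obj a) ≫ t ≫ d = c.ι.app (F.obj a) ≫ φ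
    rw [reassoc_of% h, hd, hem]
  have : StrongEpi (t ≫ d) := by rw [ht]; infer_instance
  have : StrongEpi d := strongEpi_of_strongEpi t d
  have := isIso_of_mono_of_strongEpi d
  obtain ⟨a, g, hg⟩ :=
    exists_hom_of_preservesColimit_coyoneda (colimit.isColimit E) (f ≫ inv d)
  refine ⟨F.obj a, g, ?_⟩
  rw [← hd]
  change g ≫ (colimit.cocone E).ι.app a ≫ d = f
  rw [reassoc_of% hg, IsIso.inv_hom_id, Category.comp_id]

/-- A finitely generated object is a strong quotient of a finitely presentable one. -/
lemma IsProjectiveGenerator.exists_strongQuotient [IsLocallyFinitelyPresentable.{v} C]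
    {ι : Type v} {G : ι → C} (hG : IsProjectiveGenerator G) {X : C}
    (hX : IsFinitelyGenerated X) :
    ∃ P : C, IsFinitelyPresentable.{v} P ∧ IsStrongQuotientOf X P := by
  have := Cardinal.fact_isRegular_aleph0
  obtain ⟨J, _, _, ⟨p⟩⟩ := (isCardinalFilteredGenerator_isCardinalPresentable C
    Cardinal.aleph0.{v}).exists_colimitsOfShape X
  have := isFiltered_of_isCardinalFiltered J Cardinal.aleph0.{v}
  choose I e m he hm hem using fun j => hG.exists_strongEpi_mono_factorization (p.ι.app j)
  -- Applied to the identity of `X`: one image is already all of `X`.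
  obtain ⟨j, g, hg⟩ := hG.exists_factorization_through_image p.isColimit (𝟙 X) I e m he hm
    (fun j => (hem j).trans (Category.comp_id _).symm) hX (𝟙 X)
  have : IsSplitEpi (m j) := ⟨⟨g, hg⟩⟩
  have := isIso_of_mono_of_isSplitEpi (m j)
  exact ⟨p.diag.obj j, p.prop_diag_obj j, p.ι.app j, by rw [← hem]; infer_instance⟩

/-! ### The fixpoints -/

/-- The final lfp coalgebra, presented as a filtered colimit which is preserved by
the forgetful functor. -/
lemma exists_isRationalFixpoint [IsLocallyFinitelyPresentable.{v} C] (H : C ⥤ C)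
    [PreservesFilteredColimits H] :
    ∃ (J : Type v) (_ : SmallCategory J) (_ : IsFiltered J)
      (F : J ⥤ Endofunctor.Coalgebra H) (c : Cocone F),
      Nonempty (IsColimit (carrierCocone c)) ∧ (∀ j, fpCarried H (F.obj j)) ∧
      (∀ P, fpCarried H P → Nonempty (P ⟶ c.pt)) ∧ IsRationalFixpoint H c.pt := by
  have := Cardinal.fact_isRegular_aleph0
  have : H.IsFinitelyAccessible :=
    Functor.isFinitelyAccessible_iff_preservesFilteredColimits.2 inferInstance
  obtain ⟨J, _, _, F, c, ⟨hc⟩, hF, hu⟩ := exists_colimit_presentableCarried H Cardinal.aleph0.{v}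
  have hJ := isFiltered_of_isCardinalFiltered J Cardinal.aleph0.{v}
  obtain ⟨hc'⟩ := nonempty_isColimit_of_carrierCocone hc
  refine ⟨J, inferInstance, hJ, F, c, ⟨hc⟩, hF, fun P hP => ⟨(hu P hP).some.default⟩, ⟨J, inferInstance, hJ,
    ⟨{ diag := F, ι := c.ι, isColimit := hc', prop_diag_obj := hF }⟩⟩, ?_⟩
  rintro A ⟨K, _, _, ⟨p⟩⟩
  have hp (k : K) : Nonempty (Unique (p.diag.obj k ⟶ c.pt)) := hu _ (p.prop_diag_obj k)
  have ext {k : K} (f g : p.diag.obj k ⟶ c.pt) : f = g := by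
    obtain ⟨h⟩ := hp k
    exact Subsingleton.elim f g
  let s : Cocone p.diag :=
    { pt := c.pt
      ι := { app := fun k => (hp k).some.default
             naturality := fun _ _ _ => ext _ _ } }
  exact ⟨⟨⟨p.isColimit.desc s⟩, fun f => p.isColimit.hom_ext fun k => ext _ _⟩⟩

lemma IsFinalIn.exists_iso {D : Type*} [Category* D] {P : ObjectProperty D} {X Y : D}
    (hX : IsFinalIn P X) (hY : IsFinalIn P Y) : Nonempty (X ≅ Y) := by
  obtain ⟨hX, uX⟩ := hX
  obtain ⟨hY, uY⟩ := hY
  obtain ⟨a⟩ := uX X hX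
  obtain ⟨b⟩ := uX Y hY
  obtain ⟨c⟩ := uY X hX
  obtain ⟨d⟩ := uY Y hY
  exact ⟨⟨c.default, b.default, Subsingleton.elim _ _, Subsingleton.elim _ _⟩⟩

/-- A morphism into the carrier of a subcoalgebra is a homomorphism if its composite with the
inclusion is one. -/
lemma hom_comm_of_comp_mono {H : C ⥤ C} (hmono : PreservesNonemptyMonos H)
    {A L N : Endofunctor.Coalgebra H} (m : L ⟶ N) [Mono m.f] (d : A.V ⟶ L.V) (n : A ⟶ N)
    (hd : d ≫ m.f = n.f) : A.str ≫ H.map d = d ≫ L.str := by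
  -- `H` may fail to preserve `m.f` when `L.V` is strict initial, but then `A.V` is initial too.
  by_cases h : IsStrictInitial L.V
  · obtain ⟨⟨hi⟩, h⟩ := h
    have := h d
    exact (hi.ofIso (asIso d).symm).hom_ext _ _
  · have := hmono m.f h
    rw [← cancel_mono (H.map m.f), Category.assoc, Category.assoc, m.h, ← H.map_comp, hd, n.h,
      ← hd, Category.assoc]

/-- The image of a coalgebra homomorphism is a coalgebra. -/
lemma exists_image_coalgebra {H : C ⥤ C} (hmono : PreservesNonemptyMonos H)
    {A N : Endofunctor.Coalgebra H} (n : A ⟶ N) {I : C} (e : A.V ⟶ I) (m : I ⟶ N.V)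
    [StrongEpi e] [Mono m] (hem : e ≫ m = n.f) :
    ∃ (s : I ⟶ H.obj I), A.str ≫ H.map e = e ≫ s ∧ s ≫ H.map m = m ≫ N.str := by
  by_cases h : IsStrictInitial I
  · obtain ⟨⟨hi⟩, h⟩ := h
    have := h e
    exact ⟨inv e ≫ A.str ≫ H.map e, by simp, hi.hom_ext _ _⟩
  · have := hmono m h
    have sq : CommSq (A.str ≫ H.map e) e (H.map m) (m ≫ N.str) := ⟨by
      rw [Category.assoc, ← H.map_comp, hem, n.h, reassoc_of% hem]⟩
    exact ⟨sq.lift, sq.fac_left.symm, sq.fac_right⟩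

section

variable [IsLocallyFinitelyPresentable.{v} C] {H : C ⥤ C} {ι : Type v} {G : ι → C}

/-- Every fg-carried coalgebra is a quotient coalgebra of an fp-carried one. -/
lemma exists_fpCarried_strongEpi (hG : IsProjectiveGenerator G)
    (hproj : ∀ X : C, IsFinitelyPresentable.{v} X →
      ∃ P : C, IsFinitelyPresentable.{v} P ∧ IsStrongProjective P ∧ IsStrongQuotientOf X P)
    (hepi : PreservesStrongEpis H) (A : Endofunctor.Coalgebra H) (hA : fgCarried H A) :
    ∃ P : Endofunctor.Coalgebra H, fpCarried H P ∧ ∃ q : P ⟶ A, StrongEpi q.f := by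
  obtain ⟨X, hX, q, _⟩ := hG.exists_strongQuotient hA
  obtain ⟨P, hP, hP', r, _⟩ := hproj X hX
  have := hepi (r ≫ q)
  obtain ⟨s, hs⟩ := hP' (H.map (r ≫ q)) ((r ≫ q) ≫ A.str)
  exact ⟨⟨P, s⟩, hP, ⟨r ≫ q, hs⟩, inferInstanceAs (StrongEpi (r ≫ q))⟩

/-- The locally finite fixpoint is the image of the rational fixpoint in the final coalgebra. -/
lemma exists_isLocallyFiniteFixpoint (hmono : PreservesNonemptyMonos H)
    (hG : IsProjectiveGenerator G)
    (hquot : ∀ A : Endofunctor.Coalgebra H, fgCarried H A →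
      ∃ P : Endofunctor.Coalgebra H, fpCarried H P ∧ ∃ q : P ⟶ A, StrongEpi q.f)
    {J : Type v} [SmallCategory J] [IsFiltered J] {F : J ⥤ Endofunctor.Coalgebra H} {c : Cocone F}
    (hc : IsColimit (carrierCocone c)) (hF : ∀ j, fpCarried H (F.obj j))
    (hu : ∀ P, fpCarried H P → Nonempty (P ⟶ c.pt))
    {N : Endofunctor.Coalgebra H} (hN : IsTerminal N) :
    ∃ (L : Endofunctor.Coalgebra H) (e : c.pt ⟶ L) (m : L ⟶ N),
      IsLocallyFiniteFixpoint H L ∧ StrongEpi e.f ∧ Mono m.f := by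
  obtain ⟨I, e, m, _, _, hem⟩ := hG.exists_strongEpi_mono_factorization (hN.from c.pt).f
  obtain ⟨s, hse, hsm⟩ := exists_image_coalgebra hmono (hN.from c.pt) e m hem
  let L : Endofunctor.Coalgebra H := ⟨I, s⟩
  let e' : c.pt ⟶ L := ⟨e, hse⟩
  let m' : L ⟶ N := ⟨m, hsm⟩
  have hm' : Mono m'.f := inferInstanceAs (Mono m)
  refine ⟨L, e', m', ⟨?_, fun A hA => ?_⟩, inferInstanceAs (StrongEpi e), hm'⟩
  · intro S hS f
    -- The images of the members of the diagram in `L` are fg-carried coalgebras with union `L`.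
    choose K k l hk hl hkl using fun j =>
      hG.exists_strongEpi_mono_factorization (c.ι.app j ≫ e').f
    choose t hkt htl using fun j =>
      exists_image_coalgebra hmono (c.ι.app j ≫ e') (k j) (l j) (hkl j)
    obtain ⟨j, g, hg⟩ := hG.exists_factorization_through_image hc e K k l hk hl hkl hS f
    exact ⟨⟨K j, t j⟩, hG.isFinitelyGenerated_of_strongEpi
      (isFinitelyGenerated_of_isFinitelyPresentable (hF j)) (k j), ⟨l j, htl j⟩, g, hg⟩
  · obtain ⟨d, hd⟩ : ∃ d : A.V ⟶ I, d ≫ m = (hN.from A).f := by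
      refine hG.exists_lift_of_forall _ m fun i x => ?_
      obtain ⟨P, hP, h, x', hx'⟩ :=
        hA (isFinitelyGenerated_of_isFinitelyPresentable (hG.presentable i)) x
      obtain ⟨Q, hQ, q, _⟩ := hquot P hP
      obtain ⟨r⟩ := hu Q hQ
      have h₁ : r ≫ e' ≫ m' = q ≫ h ≫ hN.from A := hN.hom_ext _ _
      -- The fill-in `P.V ⟶ I` exists although `P` itself need not map to `c.pt`.
      have sq : CommSq (r.f ≫ e) q.f m (h.f ≫ (hN.from A).f) :=
        ⟨(Category.assoc _ _ _).trans (congrArg Endofunctor.Coalgebra.Hom.f h₁)⟩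
      exact ⟨x' ≫ sq.lift, by rw [Category.assoc, sq.fac_right, reassoc_of% hx']⟩
    refine ⟨⟨⟨⟨d, hom_comm_of_comp_mono hmono m' d (hN.from A) hd⟩⟩, fun f =>
      Endofunctor.Coalgebra.ext ?_⟩⟩
    rw [← cancel_mono m'.f]
    exact (congrArg Endofunctor.Coalgebra.Hom.f (hN.hom_ext (f ≫ m') (hN.from A))).trans hd.symm

end

end LocFin

/-! ### The main theorem -/

theorem mainTheorem5 {C : Type u} [Category.{v} C]
    -- the standing assumptions on the base category and the functor
    [IsLocallyFinitelyPresentable.{v} C]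
    (H : C ⥤ C) [PreservesFilteredColimits H]
    (hmono : LocFin.PreservesNonemptyMonos H)
    -- the additional assumptions
    (hproj : ∀ X : C, IsFinitelyPresentable.{v} X →
      ∃ P : C, IsFinitelyPresentable.{v} P ∧ LocFin.IsStrongProjective P ∧
        LocFin.IsStrongQuotientOf X P)
    (hepi : LocFin.PreservesStrongEpis H) :
    -- every fg-carried coalgebra is a quotient coalgebra of an fp-carried one
    (∀ A : Coalgebra H, LocFin.fgCarried H A →
      ∃ P : Coalgebra H, LocFin.fpCarried H P ∧ ∃ q : P ⟶ A, StrongEpi q.f) ∧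
    -- the rational fixpoint, the locally finite fixpoint and the final coalgebra exist
    (∃ R : Coalgebra H, LocFin.IsRationalFixpoint H R) ∧
    (∃ L : Coalgebra H, LocFin.IsLocallyFiniteFixpoint H L) ∧
    (∃ N : Coalgebra H, Nonempty (IsTerminal N)) ∧
    -- the locally finite fixpoint is the image of the rational fixpoint in the final coalgebra
    (∀ (R L N : Coalgebra H), LocFin.IsRationalFixpoint H R →
      LocFin.IsLocallyFiniteFixpoint H L → ∀ hN : IsTerminal N,
        ∃ (e : R ⟶ L) (m : L ⟶ N), StrongEpi e.f ∧ Mono m.f ∧ e ≫ m = hN.from R) := by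
  obtain ⟨ι, G, hG⟩ := LocFin.exists_isProjectiveGenerator hproj
  have hquot := LocFin.exists_fpCarried_strongEpi hG hproj hepi
  obtain ⟨J, _, _, F, c, ⟨hc⟩, hF, hu, hR⟩ := LocFin.exists_isRationalFixpoint H
  have key {N : Endofunctor.Coalgebra H} (hN : IsTerminal N) :=
    LocFin.exists_isLocallyFiniteFixpoint hmono hG hquot hc hF hu hN
  obtain ⟨N, ⟨hN⟩⟩ := LocFin.exists_isTerminal_coalgebra H
  refine ⟨hquot, ⟨c.pt, hR⟩, ?_, ⟨N, ⟨hN⟩⟩, fun R L N hR' hL hN => ?_⟩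
  · obtain ⟨L, -, -, hL, -⟩ := key hN
    exact ⟨L, hL⟩
  · obtain ⟨L', e, m, hL', _, _⟩ := key hN
    -- Final objects are unique up to isomorphism, so the constructed factorization transports to
    -- arbitrary `R` and `L`.
    obtain ⟨i⟩ := hR'.exists_iso hR
    obtain ⟨j⟩ := hL'.exists_iso hL
    have : IsIso i.hom.f := inferInstanceAs (IsIso ((Endofunctor.Coalgebra.forget H).map i.hom))
    have : IsIso j.hom.f := inferInstanceAs (IsIso ((Endofunctor.Coalgebra.forget H).map j.hom))
    have : IsIso j.inv.f := inferInstanceAs (IsIso ((Endofunctor.Coalgebra.forget H).map j.inv))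
    exact ⟨i.hom ≫ e ≫ j.hom, j.inv ≫ m, inferInstanceAs (StrongEpi (i.hom.f ≫ e.f ≫ j.hom.f)),
      inferInstanceAs (Mono (j.inv.f ≫ m.f)), hN.hom_ext _ _⟩
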